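/- Let $S$ be a finite set. A set function $b:2^S\to\mathbb Z\cup\{+\infty\}$ with $b(\emptyset)=0$ is submodular if $b(X)+b(Y)\ge b(X\cap Y)+b(X\cup Y)$ for all $X,Y\subseteq S$ with $b(X),b(Y)$ finite; $p:2^S\to\mathbb Z\cup\{-\infty\}$ is supermodular if $-p$ is submodular. For $m\in\mathbb R^S$ write $\widetilde m(X)=\sum_{s\in X}m(s)$. Let $B\subseteq\mathbb R^S$ be the integral base-polyhedron described by an integer-valued supermodular function $p$ with $p(S)$ finite and by an integer-valued submodular function $b$, that is, $$B=\{x\in\mathbb R^S:\widetilde x(S)=p(S),\ \widetilde x(Z)\ge p(Z)\ \forall Z\subset S\}=\{x\in\mathbb R^S:\widetilde x(S)=b(S),\ \widetilde x(Z)\le b(Z)\ \forall Z\subset S\}.$$ (a) For every $c\in\mathbb Z^S$, $$\min\Big\{\sum_{s\in S}|x(s)-c(s)| : x\in B\cap\mathbb Z^S\Big\}=\max\{p(X)-b(Y)-\widetilde c(X)+\widetilde c(Y) : X,Y\subseteq S,\ X\cap Y=\emptyset\}.$$ (b) For all $c,d\in\mathbb Z^S$ with $c\le d$ (componentwise), $$\min\{\|x-y\|_1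 : x\in B\cap\mathbb Z^S,\ y\in\mathbb Z^S,\ c\le y\le d\}=\max\{p(X)-b(Y)-\widetilde d(X)+\widetilde c(Y) : X,Y\subseteq S,\ X\cap Y=\emptyset\}.$$ In both formulas the minimum and the maximum are attained, and the common value is a finite integer. -/

import Mathlib

namespace DecMin

variable {S : Type*} [Fintype S] [DecidableEq S]

/-- The modular set function `m̃(X) = ∑_{s ∈ X} m(s)` of a real vector `m`. -/
def modular (m : S → ℝ) (X : Finset S) : ℝ := ∑ s ∈ X, m s

/-- The same notation for an integer vector. -/
def modularZ (m : S → ℤ) (X : Finset S) : ℤ := ∑ s ∈ X, m s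

/-- An extended-real number that is an integer or `+∞` or `-∞`. -/
def IsExtInt (r : EReal) : Prop := r = ⊥ ∨ r = ⊤ ∨ ∃ n : ℤ, r = ((n : ℝ) : EReal)

/-- A set function is integer-valued if each of its finite values is an integer. -/
def IntValued (f : Finset S → EReal) : Prop := ∀ X, IsExtInt (f X)

/-- A (fully) submodular function: `b(∅) = 0`, the value `+∞` is allowed but `-∞` is not, and the
submodular inequality holds for every pair of subsets with finite values. -/
structure Submodular (b : Finset S → EReal) : Prop where
  empty : b ∅ = 0
  ne_bot : ∀ X, b X ≠ ⊥
  ineq : ∀ X Y, b X ≠ ⊤ → b Y ≠ ⊤ → b (X ∩ Y) + b (X ∪ Y) ≤ b X + b Y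

/-- A set function `p` is supermodular if `-p` is submodular (so `p(∅) = 0`, the value `-∞` is
allowed but `+∞` is not). -/
def Supermodular (p : Finset S → EReal) : Prop := Submodular (fun X => -p X)

/-- `B(b) = {x ∈ ℝ^S : x̃(S) = b(S), x̃(Z) ≤ b(Z) for all Z}`. -/
def baseOfSub (b : Finset S → EReal) : Set (S → ℝ) :=
  {x | (modular x Finset.univ : EReal) = b Finset.univ ∧ ∀ Z, (modular x Z : EReal) ≤ b Z}

/-- `B'(p) = {x ∈ ℝ^S : x̃(S) = p(S), x̃(Z) ≥ p(Z) for all Z}`. -/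
def baseOfSuper (p : Finset S → EReal) : Set (S → ℝ) :=
  {x | (modular x Finset.univ : EReal) = p Finset.univ ∧ ∀ Z, p Z ≤ (modular x Z : EReal)}

/-- The set of integral members of `B ⊆ ℝ^S`. -/
def intPoints (B : Set (S → ℝ)) : Set (S → ℤ) := {x | (fun s => (x s : ℝ)) ∈ B}

/-- The `ℓ₁`-distance `∑_{s ∈ S} |x(s) - y(s)|` of two integer vectors. -/
def l1dist (x y : S → ℤ) : ℤ := ∑ s, |x s - y s|

/-- The set of values `p(X) - b(Y) - d̃(X) + c̃(Y)` over all disjoint `X, Y ⊆ S`. As `p < +∞` and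
`b > -∞`, no indeterminate difference occurs; the value is `-∞` when `p(X)` or `b(Y)` is infinite. -/
def dualValues (p b : Finset S → EReal) (c d : S → ℤ) : Set EReal :=
  {r | ∃ X Y : Finset S, Disjoint X Y ∧
    r = p X - b Y - ((modularZ d X : ℝ) : EReal) + ((modularZ c Y : ℝ) : EReal)}

end DecMin

namespace DecMin

set_option linter.unusedSectionVars false

variable {S : Type*} [Fintype S] [DecidableEq S]

/-! Take an integral base `x` nearest to the box `[c, d]`. Moving one unit from `s` to `t`, with `c
s < x s`, `x t < d t` and one of the two outside the box on that side, would come nearer, so it must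
leave `B`. By integrality a tight set blocks it: a `p`-tight one containing `s` but not `t`, and
equally a `b`-tight one containing `t` but not `s`, as both functions describe `B`. Tight sets form
a lattice (`IsTight.inter_union`), so these blockers combine into one `p`-tight `X` and one
`b`-tight `Y` (`exists_dual_optimum`), for which weak duality (`dual_le_boxDist`) is an equality
(`dual_eq_boxDist`). Part (a) is the box `c = d`. -/

lemma modular_intCast (x : S → ℤ) (Z : Finset S) :
    modular (fun s => (x s : ℝ)) Z = ((modularZ x Z : ℤ) : ℝ) := by
  simp [modular, modularZ]

lemma modularZ_neg (x : S → ℤ) (Z : Finset S) : modularZ (-x) Z = -modularZ x Z := by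
  simp [modularZ]

lemma modularZ_inter_add_union (x : S → ℤ) (X Y : Finset S) :
    modularZ x (X ∩ Y) + modularZ x (X ∪ Y) = modularZ x X + modularZ x Y := by
  rw [add_comm]
  exact Finset.sum_union_inter

/-- The integer vectors `x` with `x̃ ≤ b`. -/
def IsBelow (b : Finset S → EReal) (x : S → ℤ) : Prop :=
  ∀ Z, ((modularZ x Z : ℝ) : EReal) ≤ b Z

/-- `Z` is tight for `x` with respect to `b`. -/
def IsTight (b : Finset S → EReal) (x : S → ℤ) (Z : Finset S) : Prop :=
  b Z = ((modularZ x Z : ℝ) : EReal)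

lemma mem_intPoints_baseOfSub {b : Finset S → EReal} {x : S → ℤ} :
    x ∈ intPoints (baseOfSub b) ↔ IsTight b x Finset.univ ∧ IsBelow b x := by
  simp only [intPoints, baseOfSub, Set.mem_ofPred_eq, modular_intCast, IsTight, IsBelow]
  rw [eq_comm]

lemma isTight_neg {p : Finset S → EReal} {x : S → ℤ} {Z : Finset S} :
    IsTight (fun X => -p X) (-x) Z ↔ p Z = ((modularZ x Z : ℝ) : EReal) := by
  simp only [IsTight, modularZ_neg]
  push_cast
  rw [neg_inj]

lemma isBelow_neg {p : Finset S → EReal} {x : S → ℤ} :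
    IsBelow (fun X => -p X) (-x) ↔ ∀ Z, p Z ≤ ((modularZ x Z : ℝ) : EReal) := by
  simp only [IsBelow, modularZ_neg]
  push_cast
  simp only [EReal.neg_le_neg_iff]

/-- Reflection through the origin lets the submodular lemmas serve `p` as well. -/
lemma mem_intPoints_baseOfSuper {p : Finset S → EReal} {x : S → ℤ} :
    x ∈ intPoints (baseOfSuper p) ↔ -x ∈ intPoints (baseOfSub fun X => -p X) := by
  rw [mem_intPoints_baseOfSub, isTight_neg, isBelow_neg]
  simp only [intPoints, baseOfSuper, Set.mem_ofPred_eq, modular_intCast]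
  rw [eq_comm]

lemma IntValued.neg {p : Finset S → EReal} (hp : IntValued p) : IntValued fun X => -p X := by
  intro X
  rcases hp X with h | h | ⟨n, h⟩
  · exact Or.inr (Or.inl (by simp [h]))
  · exact Or.inl (by simp [h])
  · exact Or.inr (Or.inr ⟨-n, by simp [h]⟩)

lemma isTight_empty {b : Finset S → EReal} (hb : Submodular b) (x : S → ℤ) : IsTight b x ∅ := by
  simp [IsTight, hb.empty, modularZ]

/-- A set whose bound is violated by a vector exceeding `x` by at most one on it is tight. -/
lemma isTight_of_lt {b : Finset S → EReal} (hb : Submodular b) (hbZ : IntValued b) {x : S → ℤ}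
    (hx : IsBelow b x) {Z : Finset S} {k : ℤ} (hk : k ≤ modularZ x Z + 1)
    (h : b Z < ((k : ℝ) : EReal)) : IsTight b x Z ∧ k = modularZ x Z + 1 := by
  have hxZ := hx Z
  rcases hbZ Z with h' | h' | ⟨n, h'⟩
  · exact absurd h' (hb.ne_bot Z)
  · simp [h'] at h
  · rw [IsTight]
    rw [h'] at h hxZ ⊢
    norm_cast at h hxZ ⊢
    omega

/-- Uncrossing: the bounds on `X ∩ Y` and `X ∪ Y` sum to at most those on `X` and `Y`, which `x`
attains, so neither has slack. -/
lemma IsTight.inter_union {b : Finset S → EReal} (hb : Submodular b) (hbZ : IntValued b)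
    {x : S → ℤ} (hx : IsBelow b x) {X Y : Finset S} (hX : IsTight b x X) (hY : IsTight b x Y) :
    IsTight b x (X ∩ Y) ∧ IsTight b x (X ∪ Y) := by
  have h := hb.ineq X Y (by rw [hX]; exact EReal.coe_ne_top _) (by rw [hY]; exact EReal.coe_ne_top _)
  have h1 := hx (X ∩ Y)
  have h2 := hx (X ∪ Y)
  have hm := modularZ_inter_add_union x X Y
  unfold IsTight at *
  rw [hX, hY] at h
  rcases hbZ (X ∩ Y) with e | e | ⟨n, e⟩
  · exact absurd e (hb.ne_bot _)
  · rw [e, EReal.top_add_of_ne_bot (hb.ne_bot _), ← EReal.coe_add] at h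
    exact absurd (top_le_iff.1 h) (EReal.coe_ne_top _)
  rcases hbZ (X ∪ Y) with e' | e' | ⟨m, e'⟩
  · exact absurd e' (hb.ne_bot _)
  · rw [e', EReal.add_top_of_ne_bot (hb.ne_bot _), ← EReal.coe_add] at h
    exact absurd (top_le_iff.1 h) (EReal.coe_ne_top _)
  rw [e] at h h1 ⊢
  rw [e'] at h h2 ⊢
  norm_cast at h h1 h2 ⊢
  omega

/-- In a lattice of sets, separation of points implies separation of finite sets. -/
lemma exists_separating {F : Finset S → Prop} (h0 : F ∅) (h1 : F Finset.univ)
    (hF : ∀ X Y, F X → F Y → F (X ∩ Y) ∧ F (X ∪ Y)) (A C : Finset S)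
    (h : ∀ a ∈ A, ∀ c ∈ C, ∃ Z, F Z ∧ a ∈ Z ∧ c ∉ Z) :
    ∃ Z, F Z ∧ A ⊆ Z ∧ Disjoint Z C := by
  have key : ∀ a ∈ A, ∃ Z, F Z ∧ a ∈ Z ∧ Disjoint Z C := by
    intro a ha
    choose! f hf using h a ha
    -- For empty `C` this is the whole ground set, hence the need for `h1`.
    refine ⟨C.inf f, ?_, ?_, ?_⟩
    · exact Finset.inf_induction h1 (fun X hX Y hY => (hF X Y hX hY).1) fun c hc => (hf c hc).1
    · exact Finset.singleton_subset_iff.1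
        (Finset.le_inf fun c hc => Finset.singleton_subset_iff.2 (hf c hc).2.1)
    · rw [Finset.disjoint_right]
      exact fun c hc hcZ => (hf c hc).2.2 ((Finset.inf_le hc : C.inf f ≤ f c) hcZ)
  choose! g hg using key
  refine ⟨A.sup g, ?_, ?_, ?_⟩
  · exact Finset.sup_induction h0 (fun X hX Y hY => (hF X Y hX hY).2) fun a ha => (hg a ha).1
  · exact fun a ha => (Finset.le_sup ha : g a ≤ A.sup g) (hg a ha).2.1
  · exact Finset.disjoint_sup_left.2 fun a ha => (hg a ha).2.2

lemma exists_isTight_separating {b : Finset S → EReal} (hb : Submodular b) (hbZ : IntValued b)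
    {x : S → ℤ} (hx : x ∈ intPoints (baseOfSub b)) (A C : Finset S)
    (h : ∀ a ∈ A, ∀ c ∈ C, ∃ Z, IsTight b x Z ∧ a ∈ Z ∧ c ∉ Z) :
    ∃ Z, IsTight b x Z ∧ A ⊆ Z ∧ Disjoint Z C := by
  rw [mem_intPoints_baseOfSub] at hx
  exact exists_separating (isTight_empty hb x) hx.1
    (fun X Y hX hY => hX.inter_union hb hbZ hx.2 hY) A C h

/-- The vector `x - χ_s + χ_t`. -/
def exchange (x : S → ℤ) (s t : S) : S → ℤ := x - Pi.single s 1 + Pi.single t 1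

lemma neg_exchange (x : S → ℤ) (s t : S) : -exchange x s t = exchange (-x) t s := by
  simp only [exchange]
  abel

lemma modularZ_single (s : S) (k : ℤ) (Z : Finset S) :
    modularZ (Pi.single s k) Z = if s ∈ Z then k else 0 := by
  simp [modularZ, Pi.single_apply]

lemma modularZ_add (x y : S → ℤ) (Z : Finset S) :
    modularZ (x + y) Z = modularZ x Z + modularZ y Z := by
  simp [modularZ, Finset.sum_add_distrib]

lemma modularZ_sub (x y : S → ℤ) (Z : Finset S) :
    modularZ (x - y) Z = modularZ x Z - modularZ y Z := by
  simp [modularZ]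

lemma modularZ_exchange (x : S → ℤ) (s t : S) (Z : Finset S) :
    modularZ (exchange x s t) Z
      = modularZ x Z - (if s ∈ Z then 1 else 0) + (if t ∈ Z then 1 else 0) := by
  simp only [exchange, modularZ_add, modularZ_sub, modularZ_single]

/-- An exchange keeps the total and raises any set by at most one, so by integrality only a tight
set that gains `t` without losing `s` can be violated. -/
lemma exchange_notMem_iff {b : Finset S → EReal} (hb : Submodular b) (hbZ : IntValued b)
    {x : S → ℤ} (hx : x ∈ intPoints (baseOfSub b)) (s t : S) :
    exchange x s t ∉ intPoints (baseOfSub b) ↔ ∃ Z, IsTight b x Z ∧ t ∈ Z ∧ s ∉ Z := by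
  rw [mem_intPoints_baseOfSub] at hx ⊢
  have huniv : IsTight b (exchange x s t) Finset.univ := by
    simpa [IsTight, modularZ_exchange] using hx.1
  constructor
  · intro h
    have h' : ¬ IsBelow b (exchange x s t) := fun h' => h ⟨huniv, h'⟩
    simp only [IsBelow, not_forall, not_le] at h'
    obtain ⟨Z, hZ⟩ := h'
    have hm := modularZ_exchange x s t Z
    obtain ⟨h1, h2⟩ := isTight_of_lt hb hbZ hx.2 (by split_ifs at hm <;> omega) hZ
    refine ⟨Z, h1, ?_⟩
    by_cases h3 : s ∈ Z <;> by_cases h4 : t ∈ Z <;> simp [h3, h4] at hm ⊢ <;> omega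
  · rintro ⟨Z, hZ, ht, hs⟩ ⟨-, h⟩
    have h := h Z
    rw [hZ, modularZ_exchange, if_pos ht, if_neg hs] at h
    norm_cast at h
    omega

/-- An integer-valued submodular function with `b(S)` finite has an integral base. -/
lemma intPoints_baseOfSub_nonempty {b : Finset S → EReal} (hb : Submodular b)
    (hbZ : IntValued b) (hbS : b Finset.univ ≠ ⊤) : (intPoints (baseOfSub b)).Nonempty := by
  have hfin : ∀ Z, ∃ n : ℤ, ((n : ℝ) : EReal) ≤ b Z := by
    intro Z
    rcases hbZ Z with h | h | ⟨n, h⟩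
    · exact absurd h (hb.ne_bot Z)
    · exact ⟨0, by simp [h]⟩
    · exact ⟨n, h.ge⟩
  choose f hf using hfin
  obtain ⟨N, hN⟩ : ∃ N : ℤ, b Finset.univ = ((N : ℝ) : EReal) := by
    rcases hbZ Finset.univ with h | h | h
    · exact absurd h (hb.ne_bot _)
    · exact absurd h hbS
    · exact h
  obtain ⟨x₀, hx₀⟩ : ∃ x : S → ℤ, IsBelow b x := by
    -- So negative that a single element already brings any nonempty `Z` below `f Z`.
    refine ⟨fun _ => -∑ Z, |f Z|, fun Z => ?_⟩
    rcases Z.eq_empty_or_nonempty with rfl | hZ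
    · exact (isTight_empty hb _).ge
    · refine le_trans ?_ (hf Z)
      norm_cast
      have h1 : |f Z| ≤ ∑ Z, |f Z| :=
        Finset.single_le_sum (f := fun Z => |f Z|) (fun _ _ => abs_nonneg _) (Finset.mem_univ Z)
      have h2 : (1 : ℤ) ≤ Z.card := by exact_mod_cast hZ.card_pos
      have h3 := neg_abs_le (f Z)
      have h4 := abs_nonneg (f Z)
      simp only [modularZ, Finset.sum_const, nsmul_eq_mul]
      nlinarith
  obtain ⟨v, ⟨x, hx, rfl⟩, hmax⟩ := Int.exists_greatest_of_bdd
    (P := fun r => ∃ x : S → ℤ, IsBelow b x ∧ r = modularZ x Finset.univ)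
    ⟨N, by
      rintro _ ⟨x, hx, rfl⟩
      have := hx Finset.univ
      rw [hN] at this
      exact_mod_cast this⟩ ⟨_, x₀, hx₀, rfl⟩
  -- By maximality no coordinate can be raised; the union of the blocking tight sets is all of `S`.
  have htight : ∀ s : S, ∃ Z, IsTight b x Z ∧ s ∈ Z := by
    intro s
    have h' : ¬ IsBelow b (x + Pi.single s 1) := by
      intro h'
      have := hmax _ ⟨_, h', rfl⟩
      simp [modularZ_add, modularZ_single] at this
    simp only [IsBelow, not_forall, not_le] at h'
    obtain ⟨Z, hZ⟩ := h'
    have hm := modularZ_add x (Pi.single s 1) Z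
    rw [modularZ_single] at hm
    obtain ⟨h1, h2⟩ := isTight_of_lt hb hbZ hx (by split_ifs at hm <;> omega) hZ
    refine ⟨Z, h1, ?_⟩
    by_contra h3
    simp [h3] at hm
    omega
  choose g hg using htight
  refine ⟨x, mem_intPoints_baseOfSub.2 ⟨?_, hx⟩⟩
  have : Finset.univ.sup g = Finset.univ :=
    Finset.eq_univ_of_forall fun s =>
      (Finset.le_sup (Finset.mem_univ s) : g s ≤ Finset.univ.sup g) (hg s).2
  rw [← this]
  exact Finset.sup_induction (isTight_empty hb x)
    (fun X hX Y hY => (hX.inter_union hb hbZ hx hY).2) fun s _ => (hg s).1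

/-- The `ℓ₁`-distance of `x` from the box `[c, d]`. -/
def boxDist (c d x : S → ℤ) : ℤ := ∑ s, (max 0 (x s - d s) + max 0 (c s - x s))

lemma boxDist_le_l1dist {c d x y : S → ℤ} (hy : y ∈ Set.Icc c d) :
    boxDist c d x ≤ l1dist x y := by
  refine Finset.sum_le_sum fun s _ => ?_
  have h1 : c s ≤ y s := hy.1 s
  have h2 : y s ≤ d s := hy.2 s
  rw [abs_eq_max_neg]
  omega

lemma exists_l1dist_eq_boxDist {c d : S → ℤ} (hcd : c ≤ d) (x : S → ℤ) :
    ∃ y ∈ Set.Icc c d, boxDist c d x = l1dist x y := by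
  refine ⟨fun s => max (c s) (min (x s) (d s)), ⟨fun s => ?_, fun s => ?_⟩, ?_⟩
  · exact le_max_left _ _
  · exact max_le (hcd s) (min_le_right _ _)
  · refine Finset.sum_congr rfl fun s _ => ?_
    have h : c s ≤ d s := hcd s
    simp only [abs_eq_max_neg]
    omega

lemma boxDist_exchange_lt {c d x : S → ℤ} (hcd : c ≤ d) {s t : S} (hs : c s < x s)
    (ht : x t < d t) (h : d s < x s ∨ x t < c t) :
    boxDist c d (exchange x s t) < boxDist c d x := by
  have hcs : c s ≤ d s := hcd s
  have hct : c t ≤ d t := hcd t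
  have hne : s ≠ t := by
    rintro rfl
    omega
  have hval : ∀ u, exchange x s t u = x u - (if u = s then 1 else 0) + (if u = t then 1 else 0) := by
    intro u
    simp [exchange, Pi.single_apply]
  have hle : ∀ u ∈ Finset.univ, max 0 (exchange x s t u - d u) + max 0 (c u - exchange x s t u)
      ≤ max 0 (x u - d u) + max 0 (c u - x u) := by
    intro u _
    rw [hval]
    by_cases h1 : u = s
    · subst h1
      simp only [if_true, if_neg hne]
      omega
    · by_cases h2 : u = t
      · subst h2
        simp only [if_true, if_neg h1]
        omega
      · simp [h1, h2]
  refine Finset.sum_lt_sum hle ?_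
  rcases h with h | h
  · refine ⟨s, Finset.mem_univ s, ?_⟩
    rw [hval, if_pos rfl, if_neg hne]
    omega
  · refine ⟨t, Finset.mem_univ t, ?_⟩
    rw [hval, if_pos rfl, if_neg hne.symm]
    omega

lemma dual_le_boxDist {c d x : S → ℤ} {X Y : Finset S} (hXY : Disjoint X Y) :
    modularZ x X - modularZ x Y - modularZ d X + modularZ c Y ≤ boxDist c d x := by
  have h1 : modularZ x X - modularZ d X ≤ ∑ s ∈ X, (max 0 (x s - d s) + max 0 (c s - x s)) := by
    rw [← modularZ_sub]
    exact Finset.sum_le_sum fun s _ => by simp only [Pi.sub_apply]; omega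
  have h2 : modularZ c Y - modularZ x Y ≤ ∑ s ∈ Y, (max 0 (x s - d s) + max 0 (c s - x s)) := by
    rw [← modularZ_sub]
    exact Finset.sum_le_sum fun s _ => by simp only [Pi.sub_apply]; omega
  have h3 : ∑ s ∈ X ∪ Y, (max 0 (x s - d s) + max 0 (c s - x s)) ≤ boxDist c d x :=
    Finset.sum_le_sum_of_subset_of_nonneg (Finset.subset_univ _) fun s _ _ => by omega
  rw [Finset.sum_union hXY] at h3
  linarith

/-- Complementary slackness: `X` and `Y` catch every excess and every deficit, and any further
element contributes zero. -/
lemma dual_eq_boxDist {c d x : S → ℤ} {X Y : Finset S}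
    (hX : ∀ s, d s < x s → s ∈ X) (hX' : ∀ s ∈ X, d s ≤ x s)
    (hY : ∀ s, x s < c s → s ∈ Y) (hY' : ∀ s ∈ Y, x s ≤ c s) :
    modularZ x X - modularZ x Y - modularZ d X + modularZ c Y = boxDist c d x := by
  have h1 : modularZ x X - modularZ d X = ∑ s, max 0 (x s - d s) := by
    rw [← modularZ_sub, ← Finset.sum_subset (Finset.subset_univ X)]
    · exact Finset.sum_congr rfl fun s hs => by
        have := hX' s hs
        simp only [Pi.sub_apply]
        omega
    · intro s _ hs
      have := mt (hX s) hs
      omega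
  have h2 : modularZ c Y - modularZ x Y = ∑ s, max 0 (c s - x s) := by
    rw [← modularZ_sub, ← Finset.sum_subset (Finset.subset_univ Y)]
    · exact Finset.sum_congr rfl fun s hs => by
        have := hY' s hs
        simp only [Pi.sub_apply]
        omega
    · intro s _ hs
      have := mt (hY s) hs
      omega
  rw [boxDist, Finset.sum_add_distrib]
  linarith

/-- At a minimizer of the distance from a box, tight sets certify optimality. -/
lemma exists_dual_optimum {p b : Finset S → EReal} (hp : Supermodular p) (hpZ : IntValued p)
    (hb : Submodular b) (hbZ : IntValued b) (hpb : baseOfSuper p = baseOfSub b)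
    {c d x : S → ℤ} (hcd : c ≤ d) (hx : x ∈ intPoints (baseOfSub b))
    (hmin : ∀ y ∈ intPoints (baseOfSub b), boxDist c d x ≤ boxDist c d y) :
    ∃ X Y : Finset S, Disjoint X Y ∧ p X = ((modularZ x X : ℝ) : EReal) ∧
      b Y = ((modularZ x Y : ℝ) : EReal) ∧
      modularZ x X - modularZ x Y - modularZ d X + modularZ c Y = boxDist c d x := by
  have hx' : -x ∈ intPoints (baseOfSub fun X => -p X) := by
    rwa [← mem_intPoints_baseOfSuper, hpb]
  have hno : ∀ s t, c s < x s → x t < d t → (d s < x s ∨ x t < c t) →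
      exchange x s t ∉ intPoints (baseOfSub b) := fun s t hs ht h hmem =>
    (boxDist_exchange_lt hcd hs ht h).not_ge (hmin _ hmem)
  have hiff : ∀ s t, exchange x s t ∉ intPoints (baseOfSub b) ↔
      ∃ Z, IsTight (fun X => -p X) (-x) Z ∧ s ∈ Z ∧ t ∉ Z := by
    intro s t
    rw [← hpb, mem_intPoints_baseOfSuper, neg_exchange, exchange_notMem_iff hp hpZ.neg hx']
  obtain ⟨X, hXt, hX1, hX2⟩ := exists_isTight_separating hp hpZ.neg hx'
    {s | d s < x s} {t | x t < d t} (by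
      intro s hs t ht
      simp only [Finset.mem_filter, Finset.mem_univ, true_and] at hs ht
      exact (hiff s t).1 (hno s t ((hcd s).trans_lt hs) ht (Or.inl hs)))
  have hX1' : ∀ s, d s < x s → s ∈ X := fun s hs => hX1 (by simpa using hs)
  have hX2' : ∀ s ∈ X, d s ≤ x s := fun s hs => by
    simpa using Finset.disjoint_left.1 hX2 hs
  -- Including `X` among the points to avoid makes `Y` disjoint from it. This is possible because
  -- `X` itself blocks the exchange from any `s ∈ X` to a deficient `t`.
  obtain ⟨Y, hYt, hY1, hY2⟩ := exists_isTight_separating hb hbZ hx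
    {t | x t < c t} (({s | c s < x s} : Finset S) ∪ X) (by
      intro t ht s hs
      simp only [Finset.mem_filter, Finset.mem_univ, true_and, Finset.mem_union] at hs ht
      have htd : x t < d t := ht.trans_le (hcd t)
      rw [← exchange_notMem_iff hb hbZ hx]
      rcases hs with hs | hs
      · exact hno s t hs htd (Or.inr ht)
      · exact (hiff s t).2 ⟨X, hXt, hs, fun h => (hX2' t h).not_gt htd⟩)
  rw [Finset.disjoint_union_right] at hY2
  refine ⟨X, Y, hY2.2.symm, isTight_neg.1 hXt, hYt, dual_eq_boxDist hX1' hX2'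
    (fun s hs => hY1 (by simpa using hs)) fun s hs => ?_⟩
  simpa using Finset.disjoint_left.1 hY2.1 hs

lemma isLeast_isGreatest_box {p b : Finset S → EReal} (hp : Supermodular p) (hpZ : IntValued p)
    (hpS : p Finset.univ ≠ ⊥) (hb : Submodular b) (hbZ : IntValued b)
    (hpb : baseOfSuper p = baseOfSub b) {c d : S → ℤ} (hcd : c ≤ d) :
    ∃ v : ℤ,
      IsLeast {r : ℤ | ∃ x ∈ intPoints (baseOfSub b), ∃ y ∈ Set.Icc c d, r = l1dist x y} v ∧
      IsGreatest (dualValues p b c d) ((v : ℝ) : EReal) := by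
  -- Finiteness on the full set is known for `p`, so the base is built for `-p` and reflected.
  obtain ⟨x₀, hx₀⟩ := intPoints_baseOfSub_nonempty hp hpZ.neg (by simpa using hpS)
  have hx₀' : -x₀ ∈ intPoints (baseOfSub b) := by
    rw [← hpb, mem_intPoints_baseOfSuper, neg_neg]
    exact hx₀
  obtain ⟨v, ⟨x, hx, rfl⟩, hmin⟩ := Int.exists_least_of_bdd
    (P := fun r => ∃ x ∈ intPoints (baseOfSub b), r = boxDist c d x)
    ⟨0, by
      rintro _ ⟨x, -, rfl⟩
      exact Finset.sum_nonneg fun s _ => by omega⟩ ⟨_, _, hx₀', rfl⟩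
  refine ⟨boxDist c d x, ⟨?_, ?_⟩, ?_, ?_⟩
  · obtain ⟨y, hy, h⟩ := exists_l1dist_eq_boxDist hcd x
    exact ⟨x, hx, y, hy, h⟩
  · rintro _ ⟨x', hx', y, hy, rfl⟩
    exact (hmin _ ⟨x', hx', rfl⟩).trans (boxDist_le_l1dist hy)
  · obtain ⟨X, Y, hXY, hX, hY, h⟩ := exists_dual_optimum hp hpZ hb hbZ hpb hcd hx
      fun y hy => hmin _ ⟨y, hy, rfl⟩
    refine ⟨X, Y, hXY, ?_⟩
    rw [hX, hY, ← h]
    push_cast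
    rfl
  · rintro _ ⟨X, Y, hXY, rfl⟩
    have hX : p X ≤ ((modularZ x X : ℝ) : EReal) := by
      rw [← hpb, mem_intPoints_baseOfSuper, mem_intPoints_baseOfSub, isBelow_neg] at hx
      exact hx.2 X
    have hY : ((modularZ x Y : ℝ) : EReal) ≤ b Y := (mem_intPoints_baseOfSub.1 hx).2 Y
    refine (add_le_add (EReal.sub_le_sub (EReal.sub_le_sub hX hY) le_rfl) le_rfl).trans ?_
    have h := dual_le_boxDist (c := c) (d := d) (x := x) hXY
    rw [← EReal.coe_sub, ← EReal.coe_sub, ← EReal.coe_add, EReal.coe_le_coe_iff]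
    exact_mod_cast h

end DecMin

theorem mainTheorem11 {S : Type*} [Fintype S] [DecidableEq S]
    (B : Set (S → ℝ)) (p b : Finset S → EReal)
    (hp : DecMin.Supermodular p) (hpZ : DecMin.IntValued p)
    (hpS : p Finset.univ ≠ ⊥)
    (hb : DecMin.Submodular b) (hbZ : DecMin.IntValued b)
    (hBp : B = DecMin.baseOfSuper p) (hBb : B = DecMin.baseOfSub b) :
    (∀ c : S → ℤ, ∃ v : ℤ,
      IsLeast {r : ℤ | ∃ x ∈ DecMin.intPoints B, r = DecMin.l1dist x c} v ∧
      IsGreatest (DecMin.dualValues p b c c) ((v : ℝ) : EReal)) ∧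
    (∀ c d : S → ℤ, c ≤ d → ∃ v : ℤ,
      IsLeast {r : ℤ | ∃ x ∈ DecMin.intPoints B, ∃ y ∈ Set.Icc c d, r = DecMin.l1dist x y} v ∧
      IsGreatest (DecMin.dualValues p b c d) ((v : ℝ) : EReal)) := by
  subst hBb
  refine ⟨fun c => ?_, fun c d hcd =>
    DecMin.isLeast_isGreatest_box hp hpZ hpS hb hbZ hBp.symm hcd⟩
  simpa using DecMin.isLeast_isGreatest_box hp hpZ hpS hb hbZ hBp.symm (le_refl c)
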